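/- Let $K$ be an algebraically closed field of characteristic zero, let $G$ be a finite group, and let $n\ge 0$ be an integer. A $G$-graded algebra is an associative unital $K$-algebra $A$ together with a decomposition $A=\bigoplus_{g\in G}A_g$ into $K$-subspaces such that $A_gA_h\subseteq A_{gh}$ for all $g,h\in G$; two $G$-graded algebras $A$ and $B$ are isomorphic (as $G$-graded algebras) if there is a $K$-algebra isomorphism $\varphi:A\to B$ with $\varphi(A_g)=B_g$ for all $g\in G$. Then there are only finitely many isomorphism classes of $G$-graded algebras $A$ over $K$ such that $A$ is a semisimple ring and $\dim_K A=n$. -/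

import Mathlib

universe u v w

/-- A semisimple `K`-algebra of finite dimension `n`, together with a grading by the
(multiplicatively written, not necessarily commutative) group `G`: the homogeneous components
`component g` satisfy `A = ⨁ g, A_g` and `A_g * A_h ⊆ A_{g * h}`.
Mathlib's graded algebras have additively written degrees, hence `Additive G`. -/
structure GradedSemisimpleAlgebra (K : Type v) (G : Type w) [Field K] [Group G] [DecidableEq G]
    (n : ℕ) where
  carrier : Type u
  [ring : Ring carrier]
  [algebra : Algebra K carrier]
  component : Additive G → Submodule K carrier
  [graded : GradedAlgebra component]
  semisimple : IsSemisimpleRing carrier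
  finiteDimensional : FiniteDimensional K carrier
  finrank_eq : Module.finrank K carrier = n

attribute [instance] GradedSemisimpleAlgebra.ring GradedSemisimpleAlgebra.algebra
  GradedSemisimpleAlgebra.graded

/-- `A` and `B` are isomorphic as `G`-graded algebras: some isomorphism of `K`-algebras maps the
component of degree `g` of `A` onto the component of degree `g` of `B`, for every `g`. -/
def GradedSemisimpleAlgebra.Isomorphic {K : Type v} {G : Type w} [Field K] [Group G]
    [DecidableEq G] {n : ℕ} (A B : GradedSemisimpleAlgebra.{u} K G n) : Prop :=
  ∃ φ : A.carrier ≃ₐ[K] B.carrier,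
    ∀ g : Additive G, (A.component g).map φ.toLinearMap = B.component g

/-- Graded isomorphism as an equivalence relation; its classes are the isomorphism classes. -/
def GradedSemisimpleAlgebra.isoSetoid (K : Type v) (G : Type w) [Field K] [Group G]
    [DecidableEq G] (n : ℕ) : Setoid (GradedSemisimpleAlgebra.{u} K G n) where
  r := GradedSemisimpleAlgebra.Isomorphic
  iseqv := by
    refine ⟨fun A => ⟨AlgEquiv.refl, fun g => Submodule.map_id _⟩, ?_, ?_⟩
    · rintro A B ⟨φ, hφ⟩
      refine ⟨φ.symm, fun g => ?_⟩
      rw [← hφ g]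
      ext x
      simp
    · rintro A B C ⟨φ, hφ⟩ ⟨ψ, hψ⟩
      refine ⟨φ.trans ψ, fun g => ?_⟩
      rw [← hψ g, ← hφ g, ← Submodule.map_comp]
      rfl

/-! Von Neumann regularity passes from `A` to `A_0`, so `A_0` is semisimple and `1` is a sum of
orthogonal idempotents `e i ∈ A_0` with `e i * A_0 * e i` a line. Homogeneous quasi-inverses make
nonzero elements of `e i * A_g * e j` invertible between `e i` and `e j`, so these spaces have
dimension at most one. Generators of the nonzero ones form a homogeneous basis that multiplies like
a groupoid twisted by a 2-cocycle. As in the proof that `|G|` kills `H²(G, Kˣ)`, taking the product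
of the cocycle over all arrows leaving an object yields a rescaling (`exists_rescale`) after which
every nonzero structure constant is an `n!`-th root of unity. Only finitely many tables of degrees
and constants remain, and a table determines the graded algebra. -/

/-! ### Von Neumann regularity and semisimplicity -/

/-- A semisimple ring is von Neumann regular. -/
theorem IsSemisimpleRing.exists_mul_mul_eq_self {R : Type*} [Ring R] [IsSemisimpleRing R] (x : R) :
    ∃ a, x * a * x = x := by
  obtain ⟨J, hJ⟩ := exists_isCompl (Ideal.span {x})
  have h1 : (1 : R) ∈ Ideal.span {x} ⊔ J := by rw [hJ.sup_eq_top]; trivial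
  obtain ⟨e, he, f, hf, hef⟩ := Submodule.mem_sup.1 h1
  obtain ⟨a, rfl⟩ := Ideal.mem_span_singleton'.1 he
  refine ⟨a, ?_⟩
  have hx : x - x * (a * x) = x * f := by
    rw [← eq_sub_iff_add_eq'] at hef
    rw [hef, mul_sub, mul_one]
  have h0 : x - x * (a * x) = 0 := by
    refine Submodule.disjoint_def.1 hJ.disjoint _ ?_ ?_
    · exact sub_mem (Ideal.mem_span_singleton_self x) (Ideal.mul_mem_left _ _ he)
    · rw [hx]; exact Ideal.mul_mem_left _ _ hf
  rw [mul_assoc]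
  exact (sub_eq_zero.1 h0).symm

/-- An artinian von Neumann regular ring is semisimple. -/
theorem IsSemisimpleRing.of_exists_mul_mul_eq_self {R : Type*} [Ring R] [IsArtinianRing R]
    (h : ∀ x : R, ∃ a, x * a * x = x) : IsSemisimpleRing R := by
  rw [IsArtinianRing.isSemisimpleRing_iff_jacobson, eq_bot_iff]
  intro x hx
  obtain ⟨a, ha⟩ := h x
  rw [← Ideal.jacobson_bot] at hx
  obtain ⟨z, hz⟩ := Ideal.mem_jacobson_iff.1 hx (-a)
  rw [Ideal.mem_bot, sub_eq_zero] at hz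
  have hz' : z * (1 - a * x) = 1 := Eq.trans (by noncomm_ring) hz
  -- Since `x * (1 - a * x) = 0`, a right inverse is needed; the Jacobson radical only supplies a
  -- left one.
  have hz'' : (1 - a * x) * z = 1 := by
    have : IsDedekindFiniteMonoid R := inferInstance
    exact mul_eq_one_symm hz'
  have : x * (1 - a * x) = 0 := by rw [mul_sub, mul_one, ← mul_assoc, ha, sub_self]
  calc x = x * ((1 - a * x) * z) := by rw [hz'', mul_one]
    _ = 0 := by rw [← mul_assoc, this, zero_mul]

section Graded

variable {K A Γ : Type*} [Field K] [Ring A] [Algebra K A] [AddGroup Γ] [DecidableEq Γ]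
  (𝒜 : Γ → Submodule K A) [GradedAlgebra 𝒜]

/-- Taking the degree `g` part of `x * a * x = x` leaves only the component of `a` in degree `-g`.
-/
theorem GradedAlgebra.exists_mem_mul_mul_eq_self [IsSemisimpleRing A] {g : Γ} {x : A}
    (hx : x ∈ 𝒜 g) : ∃ a ∈ 𝒜 (-g), x * a * x = x := by
  obtain ⟨a, ha⟩ := IsSemisimpleRing.exists_mul_mul_eq_self x
  refine ⟨DirectSum.decompose 𝒜 a (-g), SetLike.coe_mem _, ?_⟩
  have h1 := DirectSum.coe_decompose_mul_add_of_left_mem 𝒜 (j := -g + g) (b := a * x) hx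
  rw [DirectSum.coe_decompose_mul_add_of_right_mem 𝒜 hx, ← mul_assoc, ha, neg_add_cancel,
    add_zero, DirectSum.decompose_of_mem_same 𝒜 hx, ← mul_assoc] at h1
  exact h1.symm

theorem GradedAlgebra.isSemisimpleRing_zero [IsSemisimpleRing A] [FiniteDimensional K A] :
    IsSemisimpleRing (𝒜 0) := by
  have : IsArtinianRing (𝒜 0) := IsArtinianRing.of_finite K (𝒜 0)
  refine IsSemisimpleRing.of_exists_mul_mul_eq_self fun x => ?_
  obtain ⟨a, ha, h⟩ := exists_mem_mul_mul_eq_self 𝒜 x.2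
  rw [neg_zero] at ha
  exact ⟨⟨a, ha⟩, Subtype.ext h⟩

end Graded

/-- A split semisimple algebra has a complete system of orthogonal idempotents with
one-dimensional corners. -/
theorem IsSemisimpleRing.exists_completeOrthogonalIdempotents (K R : Type*) [Field K]
    [IsAlgClosed K] [Ring R] [Algebra K R] [FiniteDimensional K R] [IsSemisimpleRing R] :
    ∃ (ι : Type) (_ : Fintype ι) (e : ι → R), CompleteOrthogonalIdempotents e ∧
      ∀ i x, ∃ c : K, e i * x * e i = c • e i := by
  obtain ⟨k, d, -, ⟨φ⟩⟩ := exists_algEquiv_pi_matrix_of_isAlgClosed K R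
  let E : (Σ i, Fin (d i)) → Π i, Matrix (Fin (d i)) (Fin (d i)) K :=
    fun s => Pi.single s.1 (Matrix.single s.2 s.2 1)
  have hE : CompleteOrthogonalIdempotents E := by
    refine ⟨⟨fun s => ?_, ?_⟩, ?_⟩
    · simp [E, IsIdempotentElem, ← Pi.single_mul]
    · rintro ⟨i, a⟩ ⟨j, b⟩ h
      by_cases hij : i = j
      · subst hij
        have hab : a ≠ b := fun hab => h (by rw [hab])
        simp [E, ← Pi.single_mul, hab]
      · funext l
        by_cases hl : l = i
        · subst hl
          simp [E, hij]
        · simp [E, hl]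
    · rw [Fintype.sum_sigma]
      funext l
      ext a b
      simp only [E, Finset.sum_apply, Matrix.sum_apply]
      rw [Finset.sum_eq_single l]
      · simp [Matrix.single_apply, Matrix.one_apply, Finset.filter_and,
          Finset.filter_eq']
        split_ifs <;> simp_all
      · intro b _ hb
        simp [Pi.single_eq_of_ne hb.symm]
      · simp
  refine ⟨Σ i, Fin (d i), inferInstance, fun s => φ.symm (E s), ?_, fun s x => ?_⟩
  · exact hE.map φ.symm.toAlgHom.toRingHom
  · refine ⟨φ x s.1 s.2 s.2, φ.injective ?_⟩
    simp only [map_mul, AlgEquiv.apply_symm_apply, map_smul]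
    funext l
    by_cases hl : l = s.1
    · subst hl
      simp [E, Matrix.single_mul_mul_single]
    · simp [E, hl]

/-! ### Twisted groupoids and normalization of the cocycle -/

section Rescale

variable {K A ι Γ : Type*} [Field K] [Ring A] [Algebra K A] [AddGroup Γ]

/-- A family `b i j g` of elements of an algebra which multiply, up to nonzero scalars, like the
arrows of a groupoid over `ι`; the arrows are those `(i, j, g)` with `b i j g ≠ 0`. -/
structure IsTwistedGroupoid (K : Type*) {A ι Γ : Type*} [Field K] [Ring A] [Algebra K A]
    [AddGroup Γ] (b : ι → ι → Γ → A) : Prop where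
  mul_ne_zero : ∀ {i j l g h}, b i j g ≠ 0 → b j l h ≠ 0 → b i l (g + h) ≠ 0
  mul_eq : ∀ {i j l g h}, b i j g ≠ 0 → b j l h ≠ 0 →
    ∃ c : K, c ≠ 0 ∧ b i j g * b j l h = c • b i l (g + h)
  rev_ne_zero : ∀ {i j g}, b i j g ≠ 0 → b j i (-g) ≠ 0

namespace IsTwistedGroupoid

variable {b : ι → ι → Γ → A} (hb : IsTwistedGroupoid K b)
include hb

theorem ne_zero_iff {j l : ι} {h : Γ} (hh : b j l h ≠ 0) (p : ι) (q : Γ) :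
    b j p (h + q) ≠ 0 ↔ b l p q ≠ 0 := by
  refine ⟨fun H => ?_, fun H => hb.mul_ne_zero hh H⟩
  simpa using hb.mul_ne_zero (hb.rev_ne_zero hh) H

open Classical in
/-- After rescaling, the structure constants are roots of unity of bounded order. -/
theorem exists_rescale [IsAlgClosed K] [Fintype ι] [Fintype Γ] :
    ∃ r : ι → ι → Γ → K, (∀ i j g, r i j g ≠ 0) ∧ ∀ i j l g h, b i j g ≠ 0 → b j l h ≠ 0 →
      ∃ c : K, c ^ (Fintype.card {s : ι × ι × Γ // b s.1 s.2.1 s.2.2 ≠ 0}).factorial = 1 ∧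
        (r i j g • b i j g) * (r j l h • b j l h) = c • (r i l (g + h) • b i l (g + h)) := by
  -- The value `1` when the second factor is not an arrow turns products over `ι × Γ` into products
  -- over the arrows leaving an object.
  have hσ : ∀ i j g l h, ∃ c : K, c ≠ 0 ∧ (b j l h = 0 → c = 1) ∧
      (b i j g ≠ 0 → b j l h ≠ 0 → b i j g * b j l h = c • b i l (g + h)) := by
    intro i j g l h
    by_cases h1 : b i j g ≠ 0
    · by_cases h2 : b j l h ≠ 0
      · obtain ⟨c, hc, hc'⟩ := hb.mul_eq h1 h2
        exact ⟨c, hc, fun h => absurd h h2, fun _ _ => hc'⟩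
      · exact ⟨1, one_ne_zero, fun _ => rfl, fun _ h => absurd h h2⟩
    · exact ⟨1, one_ne_zero, fun _ => rfl, fun h => absurd h h1⟩
  choose σ hσ0 hσ1 hσ using hσ
  let m : ι → ℕ := fun j => Fintype.card {s : ι × Γ // b j s.1 s.2 ≠ 0}
  let μ : ι → ι → Γ → K := fun i j g => ∏ s : ι × Γ, σ i j g s.1 s.2
  have hμ0 : ∀ i j g, μ i j g ≠ 0 := fun i j g => Finset.prod_ne_zero_iff.2 fun s _ => hσ0 _ _ _ _ _
  have hroot : ∀ i j g, ∃ r : K, r ≠ 0 ∧ (m j ≠ 0 → r ^ m j = μ i j g) := by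
    intro i j g
    by_cases hm : m j = 0
    · exact ⟨1, one_ne_zero, fun h => absurd hm h⟩
    · obtain ⟨z, hz⟩ := IsAlgClosed.exists_pow_nat_eq (μ i j g) (Nat.pos_of_ne_zero hm)
      refine ⟨z, ?_, fun _ => hz⟩
      rintro rfl
      rw [zero_pow hm] at hz
      exact hμ0 i j g hz.symm
  choose r hr0 hr using hroot
  refine ⟨fun i j g => (r i j g)⁻¹, fun i j g => inv_ne_zero (hr0 i j g), ?_⟩
  intro i j l g h hg hh
  -- Composition with the arrow `(j, l, h)` matches arrows leaving `l` with arrows leaving `j`.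
  let E : ι × Γ ≃ ι × Γ := Equiv.prodCongr (Equiv.refl ι) (Equiv.addLeft h)
  have hE : ∀ s : ι × Γ, b j (E s).1 (E s).2 ≠ 0 ↔ b l s.1 s.2 ≠ 0 := fun s =>
    hb.ne_zero_iff hh s.1 s.2
  have hml : m l = m j := Fintype.card_congr (E.subtypeEquiv fun s => (hE s).symm)
  have hm0 : m l ≠ 0 :=
    (Fintype.card_pos_iff.2 ⟨⟨⟨j, -h⟩, hb.rev_ne_zero hh⟩⟩).ne'
  -- The cocycle identity, from associativity of a triple product; off the arrows every factor is
  -- `1`.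
  have hcoc : ∀ s : ι × Γ, (if b l s.1 s.2 ≠ 0 then σ i j g l h else 1) *
      σ i l (g + h) s.1 s.2 = σ i j g (E s).1 (E s).2 * σ j l h s.1 s.2 := by
    intro s
    split_ifs with hs
    · have hjs : b j s.1 (h + s.2) ≠ 0 := (hE s).2 hs
      have his : b i s.1 (g + (h + s.2)) ≠ 0 := hb.mul_ne_zero hg hjs
      refine smul_left_injective K his ?_
      change (_ * _) • _ = (σ i j g s.1 (h + s.2) * _) • _
      rw [mul_smul, ← add_assoc, ← hσ i l _ _ _ (hb.mul_ne_zero hg hh) hs, ← smul_mul_assoc,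
        ← hσ i j _ _ _ hg hh, mul_assoc, hσ j l _ _ _ hh hs, mul_smul_comm,
        hσ i j _ _ _ hg hjs, smul_smul, add_assoc, mul_comm]
    · rw [hσ1 _ _ _ _ _ (not_not.1 hs), hσ1 _ _ _ _ _ (not_not.1 fun H => hs ((hE s).1 H)),
        hσ1 _ _ _ _ _ (not_not.1 hs)]
  have hprod : σ i j g l h ^ m l * μ i l (g + h) = μ i j g * μ j l h := by
    have := Finset.prod_congr (rfl : (Finset.univ : Finset (ι × Γ)) = _) fun s _ => hcoc s
    rw [Finset.prod_mul_distrib, Finset.prod_mul_distrib,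
      Equiv.prod_comp E (fun s => σ i j g s.1 s.2), Finset.prod_ite, Finset.prod_const,
      Finset.prod_const_one, mul_one, ← Fintype.card_subtype] at this
    exact this
  refine ⟨σ i j g l h * r i l (g + h) * (r i j g)⁻¹ * (r j l h)⁻¹, ?_, ?_⟩
  · have h1 : (σ i j g l h * r i l (g + h) * (r i j g)⁻¹ * (r j l h)⁻¹) ^ m l = 1 := by
      rw [mul_pow, mul_pow, mul_pow, inv_pow, inv_pow, hr i l _ hm0, hr j l _ hm0, hprod, hml,
        hr i j _ (hml ▸ hm0)]
      field_simp [hμ0 i j g, hμ0 j l h]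
    -- The order `m l` depends on the object; the factorial is a common multiple.
    have hle : m l ≤ Fintype.card {s : ι × ι × Γ // b s.1 s.2.1 s.2.2 ≠ 0} :=
      Fintype.card_le_of_injective (fun s => ⟨⟨l, s.1.1, s.1.2⟩, s.2⟩) fun s t hst => by
        simpa [Subtype.ext_iff, Prod.ext_iff] using hst
    obtain ⟨k, hk⟩ := Nat.dvd_factorial (Nat.pos_of_ne_zero hm0) hle
    rw [hk, pow_mul, h1, one_pow]
  · rw [smul_mul_smul_comm, hσ i j _ _ _ hg hh, smul_smul, smul_smul]
    congr 1
    field_simp [hr0 i l (g + h)]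

end IsTwistedGroupoid

end Rescale

/-! ### Graded Peirce components -/

section Peirce

variable {K A Γ ι : Type*} [Field K] [Ring A] [Algebra K A] [AddGroup Γ]
  (𝒜 : Γ → Submodule K A)

/-- The elements of degree `g` in the Peirce component `e i * A * e j`. -/
def gradedPeirce (e : ι → A) (i j : ι) (g : Γ) : Submodule K A where
  carrier := {x | x ∈ 𝒜 g ∧ e i * x = x ∧ x * e j = x}
  zero_mem' := by simp
  add_mem' := by
    rintro x y ⟨h1, h2, h3⟩ ⟨h4, h5, h6⟩
    exact ⟨add_mem h1 h4, by rw [mul_add, h2, h5], by rw [add_mul, h3, h6]⟩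
  smul_mem' := by
    rintro c x ⟨h1, h2, h3⟩
    exact ⟨Submodule.smul_mem _ _ h1, by rw [mul_smul_comm, h2], by rw [smul_mul_assoc, h3]⟩

variable {𝒜} {e : ι → A}

theorem exists_eq_smul_of_mem_gradedPeirce (hc : ∀ i, ∀ x ∈ 𝒜 0, ∃ c : K, e i * x * e i = c • e i)
    {i : ι} {x : A} (hx : x ∈ gradedPeirce 𝒜 e i i 0) : ∃ c : K, x = c • e i := by
  obtain ⟨c, h⟩ := hc i x hx.1
  rw [hx.2.1, hx.2.2] at h
  exact ⟨c, h⟩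

variable [DecidableEq Γ] [GradedAlgebra 𝒜]

theorem mul_mem_gradedPeirce {i j l : ι} {g h : Γ} {x y : A} (hx : x ∈ gradedPeirce 𝒜 e i j g)
    (hy : y ∈ gradedPeirce 𝒜 e j l h) : x * y ∈ gradedPeirce 𝒜 e i l (g + h) :=
  ⟨SetLike.mul_mem_graded hx.1 hy.1, by rw [← mul_assoc, hx.2.1], by rw [mul_assoc, hy.2.2]⟩

theorem mul_mul_mem_gradedPeirce (he : ∀ i, IsIdempotentElem (e i)) (h0 : ∀ i, e i ∈ 𝒜 0)
    (i j : ι) {g : Γ} {x : A} (hx : x ∈ 𝒜 g) : e i * x * e j ∈ gradedPeirce 𝒜 e i j g := by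
  refine ⟨?_, ?_, ?_⟩
  · simpa using SetLike.mul_mem_graded (SetLike.mul_mem_graded (h0 i) hx) (h0 j)
  · rw [← mul_assoc, ← mul_assoc, (he i).eq]
  · rw [mul_assoc, (he j).eq]

/-- For a quasi-inverse `y` cut down to the corner, `x * y` and `y * x` are scalar multiples of
idempotents, and `x * y * x = x` forces both scalars to be `1`. -/
theorem exists_inv_of_mem_gradedPeirce [IsSemisimpleRing A] (he : ∀ i, IsIdempotentElem (e i))
    (h0 : ∀ i, e i ∈ 𝒜 0) (hc : ∀ i, ∀ x ∈ 𝒜 0, ∃ c : K, e i * x * e i = c • e i)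
    {i j : ι} {g : Γ} {x : A} (hx : x ∈ gradedPeirce 𝒜 e i j g) (hx0 : x ≠ 0) :
    ∃ y ∈ gradedPeirce 𝒜 e j i (-g), x * y = e i ∧ y * x = e j := by
  obtain ⟨a, ha, hax⟩ := GradedAlgebra.exists_mem_mul_mul_eq_self 𝒜 hx.1
  have hy := mul_mul_mem_gradedPeirce he h0 j i ha
  have hyx : x * (e j * a * e i) * x = x := by
    rw [← mul_assoc, ← mul_assoc, hx.2.2, mul_assoc (x * a), hx.2.1, hax]
  generalize e j * a * e i = y at hy hyx
  refine ⟨y, hy, ?_, ?_⟩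
  · have h1 := mul_mem_gradedPeirce hx hy
    rw [add_neg_cancel] at h1
    obtain ⟨c, h1⟩ := exists_eq_smul_of_mem_gradedPeirce hc h1
    rw [h1, smul_mul_assoc, hx.2.1] at hyx
    have : c = 1 := smul_left_injective K hx0 (by simpa using hyx)
    rw [h1, this, one_smul]
  · have h1 := mul_mem_gradedPeirce hy hx
    rw [neg_add_cancel] at h1
    obtain ⟨c, h1⟩ := exists_eq_smul_of_mem_gradedPeirce hc h1
    rw [mul_assoc, h1, mul_smul_comm, hx.2.2] at hyx
    have : c = 1 := smul_left_injective K hx0 (by simpa using hyx)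
    rw [h1, this, one_smul]

/-- Multiplication by the inverse of a nonzero `b` carries the component into the scalar multiples
of `e j`. -/
theorem exists_forall_mem_gradedPeirce_eq_smul [IsSemisimpleRing A]
    (he : ∀ i, IsIdempotentElem (e i))
    (h0 : ∀ i, e i ∈ 𝒜 0) (hc : ∀ i, ∀ x ∈ 𝒜 0, ∃ c : K, e i * x * e i = c • e i)
    (i j : ι) (g : Γ) :
    ∃ b ∈ gradedPeirce 𝒜 e i j g, ∀ x ∈ gradedPeirce 𝒜 e i j g, ∃ c : K, x = c • b := by
  by_cases h : ∃ b ∈ gradedPeirce 𝒜 e i j g, b ≠ 0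
  · obtain ⟨b, hb, hb0⟩ := h
    refine ⟨b, hb, fun x hx => ?_⟩
    obtain ⟨y, hy, hby, -⟩ := exists_inv_of_mem_gradedPeirce he h0 hc hb hb0
    have h1 := mul_mem_gradedPeirce hy hx
    rw [neg_add_cancel] at h1
    obtain ⟨c, h1⟩ := exists_eq_smul_of_mem_gradedPeirce hc h1
    refine ⟨c, ?_⟩
    rw [← hx.2.1, ← hby, mul_assoc, h1, mul_smul_comm, hb.2.2]
  · push Not at h
    exact ⟨0, zero_mem _, fun x hx => ⟨0, by rw [h x hx, smul_zero]⟩⟩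

theorem isTwistedGroupoid_of_mem_gradedPeirce [IsSemisimpleRing A]
    (he : ∀ i, IsIdempotentElem (e i))
    (h0 : ∀ i, e i ∈ 𝒜 0) (hc : ∀ i, ∀ x ∈ 𝒜 0, ∃ c : K, e i * x * e i = c • e i)
    {b : ι → ι → Γ → A} (hb : ∀ i j g, b i j g ∈ gradedPeirce 𝒜 e i j g)
    (hspan : ∀ i j g, ∀ x ∈ gradedPeirce 𝒜 e i j g, ∃ c : K, x = c • b i j g) :
    IsTwistedGroupoid K b := by
  have key : ∀ {i j l g h}, b i j g ≠ 0 → b j l h ≠ 0 → b i j g * b j l h ≠ 0 := by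
    intro i j l g h hg hh H
    obtain ⟨y, hy, -, hyb⟩ := exists_inv_of_mem_gradedPeirce he h0 hc (hb i j g) hg
    apply hh
    rw [← (hb j l h).2.1, ← hyb, mul_assoc, H, mul_zero]
  refine ⟨?_, ?_, ?_⟩
  · intro i j l g h hg hh H
    obtain ⟨c, hc'⟩ := hspan _ _ _ _ (mul_mem_gradedPeirce (hb i j g) (hb j l h))
    exact key hg hh (by rw [hc', H, smul_zero])
  · intro i j l g h hg hh
    obtain ⟨c, hc'⟩ := hspan _ _ _ _ (mul_mem_gradedPeirce (hb i j g) (hb j l h))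
    refine ⟨c, ?_, hc'⟩
    rintro rfl
    exact key hg hh (by rw [hc', zero_smul])
  · intro i j g hg H
    obtain ⟨y, hy, hby, -⟩ := exists_inv_of_mem_gradedPeirce he h0 hc (hb i j g) hg
    obtain ⟨c, hc'⟩ := hspan _ _ _ _ hy
    apply hg
    rw [← (hb i j g).2.1, ← hby, hc', H]
    simp

end Peirce

/-! ### The normalized homogeneous basis -/

section Basis

open Module

variable {K A Γ : Type*} [Field K] [IsAlgClosed K] [Ring A] [Algebra K A] [FiniteDimensional K A]
  [IsSemisimpleRing A] [AddGroup Γ] [Finite Γ] [DecidableEq Γ]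
  (𝒜 : Γ → Submodule K A) [GradedAlgebra 𝒜]

theorem exists_homogeneous_basis_pow_eq_one :
    ∃ (v : Basis (Fin (finrank K A)) K A) (d : Fin (finrank K A) → Γ), (∀ s, v s ∈ 𝒜 (d s)) ∧
      ∀ s t k, v.repr (v s * v t) k = 0 ∨ v.repr (v s * v t) k ^ (finrank K A).factorial = 1 := by
  classical
  have := Fintype.ofFinite Γ
  have := GradedAlgebra.isSemisimpleRing_zero 𝒜
  obtain ⟨ι, _, e, he, hc⟩ := IsSemisimpleRing.exists_completeOrthogonalIdempotents K (𝒜 0)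
  replace he := he.map (SetLike.GradeZero.subring 𝒜).subtype
  replace hc : ∀ i, ∀ x ∈ 𝒜 0, ∃ c : K, (e i : A) * x * e i = c • (e i : A) := fun i x hx => by
    obtain ⟨c, h⟩ := hc i ⟨x, hx⟩
    exact ⟨c, congrArg Subtype.val h⟩
  have h0 : ∀ i, (e i : A) ∈ 𝒜 0 := fun i => (e i).2
  generalize hE : (fun i => (e i : A)) = E at *
  replace he : CompleteOrthogonalIdempotents E := by rw [← hE]; exact he
  replace hc : ∀ i, ∀ x ∈ 𝒜 0, ∃ c : K, E i * x * E i = c • E i := by rw [← hE]; exact hc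
  replace h0 : ∀ i, E i ∈ 𝒜 0 := by rw [← hE]; exact h0
  choose b hb hspan using exists_forall_mem_gradedPeirce_eq_smul he.idem h0 hc
  have hG := isTwistedGroupoid_of_mem_gradedPeirce he.idem h0 hc hb hspan
  obtain ⟨r, hr0, hr⟩ := hG.exists_rescale
  let S := {s : ι × ι × Γ // b s.1 s.2.1 s.2.2 ≠ 0}
  let w : S → A := fun s => r s.1.1 s.1.2.1 s.1.2.2 • b s.1.1 s.1.2.1 s.1.2.2
  have hw : ∀ s : S, w s ∈ gradedPeirce 𝒜 E s.1.1 s.1.2.1 s.1.2.2 := fun s =>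
    Submodule.smul_mem _ _ (hb _ _ _)
  have hw0 : ∀ s : S, w s ≠ 0 := fun s => smul_ne_zero (hr0 _ _ _) s.2
  -- Projection to the Peirce component and degree of `t`; it kills every `w s` with `s ≠ t`.
  let p : S → A →ₗ[K] A := fun t => GradedAlgebra.proj 𝒜 t.1.2.2 ∘ₗ
    LinearMap.mulLeft K (E t.1.1) ∘ₗ LinearMap.mulRight K (E t.1.2.1)
  have hp : ∀ s t, p t (w s) = if s = t then w t else 0 := by
    intro s t
    change GradedAlgebra.proj 𝒜 t.1.2.2 (E t.1.1 * (w s * E t.1.2.1)) = _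
    by_cases h2 : s.1.2.1 = t.1.2.1
    · by_cases h1 : s.1.1 = t.1.1
      · rw [← h2, ← h1, (hw s).2.2, (hw s).2.1, GradedAlgebra.proj_apply]
        by_cases h3 : s.1.2.2 = t.1.2.2
        · have hst : s = t := Subtype.ext (Prod.ext h1 (Prod.ext h2 h3))
          subst hst
          rw [if_pos rfl, DirectSum.decompose_of_mem_same 𝒜 (hw s).1]
        · rw [if_neg (fun h => h3 (by rw [h])), DirectSum.decompose_of_mem_ne 𝒜 (hw s).1 h3]
      · rw [if_neg (fun h => h1 (by rw [h])), ← (hw s).2.1, mul_assoc, ← mul_assoc,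
          he.ortho (Ne.symm h1), zero_mul, map_zero]
    · rw [if_neg (fun h => h2 (by rw [h])), ← (hw s).2.2, mul_assoc, he.ortho h2, mul_zero,
        mul_zero, map_zero]
  have hli : LinearIndependent K w := by
    rw [Fintype.linearIndependent_iff]
    intro c hsum t
    have := congrArg (p t) hsum
    simp_rw [map_sum, map_smul, hp, map_zero] at this
    rw [Finset.sum_eq_single t (fun s _ hs => by rw [if_neg hs, smul_zero])
      (fun h => absurd (Finset.mem_univ t) h), if_pos rfl] at this
    exact (smul_eq_zero.1 this).resolve_right (hw0 t)
  have hsp : ⊤ ≤ Submodule.span K (Set.range w) := by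
    intro a _
    induction a using DirectSum.Decomposition.inductionOn 𝒜 with
    | zero => exact zero_mem _
    | add x y hx hy => exact add_mem (hx trivial) (hy trivial)
    | homogeneous a =>
      rename_i g _
      have ha : (a : A) = ∑ i, ∑ j, E i * a * E j := by
        simp_rw [← Finset.mul_sum, he.complete, mul_one, ← Finset.sum_mul, he.complete, one_mul]
      rw [ha]
      refine Submodule.sum_mem _ fun i _ => Submodule.sum_mem _ fun j _ => ?_
      obtain ⟨c, hc'⟩ := hspan i j g _ (mul_mul_mem_gradedPeirce he.idem h0 i j a.2)
      rw [hc']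
      by_cases hbz : b i j g = 0
      · rw [hbz, smul_zero]
        exact zero_mem _
      · have : b i j g = (r i j g)⁻¹ • w ⟨(i, j, g), hbz⟩ := by
          rw [smul_smul, inv_mul_cancel₀ (hr0 _ _ _), one_smul]
        rw [this]
        exact Submodule.smul_mem _ _ (Submodule.smul_mem _ _ (Submodule.subset_span ⟨_, rfl⟩))
  let B : Basis S K A := Basis.mk hli hsp
  have hBw : ∀ s, B s = w s := Basis.mk_apply hli hsp
  -- The arrows index a basis, so the exponent depends on the dimension alone.
  have hcard : finrank K A = Fintype.card S := finrank_eq_card_basis B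
  have hmul : ∀ s t k : S, B.repr (B s * B t) k = 0 ∨
      B.repr (B s * B t) k ^ (finrank K A).factorial = 1 := by
    rintro ⟨⟨i, j, g⟩, hs⟩ ⟨⟨j', l, h⟩, ht⟩ k
    by_cases hj : j = j'
    · subst hj
      obtain ⟨c, hc1, hc2⟩ := hr i j l g h hs ht
      have : B ⟨(i, j, g), hs⟩ * B ⟨(j, l, h), ht⟩ =
          c • B ⟨(i, l, g + h), hG.mul_ne_zero hs ht⟩ := by
        rw [hBw, hBw, hBw]
        exact hc2
      rw [this, map_smul, Basis.repr_self, Finsupp.smul_single, smul_eq_mul, mul_one,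
        Finsupp.single_apply]
      split_ifs
      · right
        rw [hcard]
        exact hc1
      · exact Or.inl rfl
    · left
      have : B ⟨(i, j, g), hs⟩ * B ⟨(j', l, h), ht⟩ = 0 := by
        rw [hBw, hBw, ← (hw _).2.2, mul_assoc, ← (hw ⟨(j', l, h), ht⟩).2.1, ← mul_assoc (E _),
          he.ortho hj, zero_mul, mul_zero]
      rw [this, map_zero, Finsupp.zero_apply]
  let φ : S ≃ Fin (finrank K A) := Fintype.equivFinOfCardEq hcard.symm
  refine ⟨B.reindex φ, fun s => (φ.symm s).1.2.2, fun s => ?_, fun s t k => ?_⟩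
  · rw [Basis.reindex_apply, hBw]
    exact (hw _).1
  · rw [Basis.reindex_apply, Basis.reindex_apply, Basis.repr_reindex_apply]
    exact hmul _ _ _

end Basis

/-! ### Structure constants determine the isomorphism class -/

namespace GradedSemisimpleAlgebra

open Module

variable {K : Type v} {G : Type w} [Field K] [Group G] [DecidableEq G] {n : ℕ}

/-- Two graded algebras having homogeneous bases with equal degrees and structure constants
are isomorphic. -/
theorem isomorphic_of_basis {A B : GradedSemisimpleAlgebra.{u} K G n}
    (v : Basis (Fin n) K A.carrier) (v' : Basis (Fin n) K B.carrier) (d : Fin n → Additive G)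
    (hv : ∀ s, v s ∈ A.component (d s)) (hv' : ∀ s, v' s ∈ B.component (d s))
    (h : ∀ s t k, v.repr (v s * v t) k = v'.repr (v' s * v' t) k) : A.Isomorphic B := by
  let f : A.carrier ≃ₗ[K] B.carrier := v.equiv v' (Equiv.refl _)
  have hf : ∀ s, f (v s) = v' s := fun s => v.equiv_apply s v' (Equiv.refl _)
  have hmul : ∀ x y, f (x * y) = f x * f y := by
    have : (LinearMap.mul K A.carrier).compr₂ f.toLinearMap =
        (LinearMap.mul K B.carrier).compl₁₂ f.toLinearMap f.toLinearMap := by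
      refine v.ext fun s => v.ext fun t => ?_
      change f (v s * v t) = f (v s) * f (v t)
      rw [hf, hf, ← v.sum_repr (v s * v t), ← v'.sum_repr (v' s * v' t), map_sum]
      simp_rw [map_smul, hf, h]
    exact fun x y => LinearMap.congr_fun₂ this x y
  have hone : f 1 = 1 := by
    have := hmul 1 (f.symm 1)
    rwa [one_mul, f.apply_symm_apply, mul_one, eq_comm] at this
  -- Commuting with the projections gives both inclusions between the image of a component and its
  -- target.
  have hproj : ∀ g x, f (GradedAlgebra.proj A.component g x) =
      GradedAlgebra.proj B.component g (f x) := by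
    intro g
    refine LinearMap.congr_fun (f := f.toLinearMap ∘ₗ GradedAlgebra.proj A.component g)
      (g := GradedAlgebra.proj B.component g ∘ₗ f.toLinearMap) (v.ext fun s => ?_)
    change f (GradedAlgebra.proj A.component g (v s)) = GradedAlgebra.proj B.component g (f (v s))
    rw [hf, GradedAlgebra.proj_apply, GradedAlgebra.proj_apply]
    by_cases hg : d s = g
    · subst hg
      rw [DirectSum.decompose_of_mem_same _ (hv s), DirectSum.decompose_of_mem_same _ (hv' s), hf]
    · rw [DirectSum.decompose_of_mem_ne _ (hv s) hg, DirectSum.decompose_of_mem_ne _ (hv' s) hg,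
        map_zero]
  refine ⟨AlgEquiv.ofLinearEquiv f hone hmul, fun g => le_antisymm ?_ fun y hy => ?_⟩
  · rintro _ ⟨x, hx, rfl⟩
    change f x ∈ B.component g
    have := hproj g x
    rw [GradedAlgebra.proj_apply, DirectSum.decompose_of_mem_same _ hx] at this
    rw [this]
    exact SetLike.coe_mem _
  · refine ⟨GradedAlgebra.proj A.component g (f.symm y), SetLike.coe_mem _, ?_⟩
    change f _ = y
    rw [hproj, f.apply_symm_apply, GradedAlgebra.proj_apply, DirectSum.decompose_of_mem_same _ hy]

end GradedSemisimpleAlgebra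

theorem mainTheorem12 (K : Type v) [Field K] [IsAlgClosed K] [CharZero K]
    (G : Type w) [Group G] [Finite G] [DecidableEq G] (n : ℕ) :
    Finite (Quotient (GradedSemisimpleAlgebra.isoSetoid.{u} K G n)) := by
  have hA : ∀ A : GradedSemisimpleAlgebra.{u} K G n,
      ∃ (v : Module.Basis (Fin n) K A.carrier) (d : Fin n → Additive G),
        (∀ s, v s ∈ A.component (d s)) ∧ ∀ s t k, v.repr (v s * v t) k = 0 ∨
          v.repr (v s * v t) k ^ n.factorial = 1 := by
    intro A
    have := A.semisimple
    have := A.finiteDimensional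
    have : Finite (Additive G) := ‹Finite G›
    have := exists_homogeneous_basis_pow_eq_one A.component
    rwa [A.finrank_eq] at this
  choose v d hd hv using hA
  let R : Set K := {c | c = 0 ∨ c ^ n.factorial = 1}
  have hR : R.Finite := by
    refine (Set.finite_singleton 0).union
      ((Polynomial.nthRootsFinset n.factorial (1 : K)).finite_toSet.subset fun c hc => ?_)
    exact (Polynomial.mem_nthRootsFinset n.factorial_pos _).2 hc
  have : Finite R := hR
  have : Finite (Additive G) := ‹Finite G›
  -- Degrees and structure constants, a point of a finite set; on chosen representatives it
  -- separates classes.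
  let code : GradedSemisimpleAlgebra.{u} K G n →
      (Fin n → Additive G) × (Fin n → Fin n → Fin n → R) :=
    fun A => (d A, fun s t k => ⟨(v A).repr (v A s * v A t) k, hv A s t k⟩)
  refine Finite.of_injective (fun q : Quotient (GradedSemisimpleAlgebra.isoSetoid.{u} K G n) =>
    code q.out) fun q q' hq => ?_
  rw [← q.out_eq, ← q'.out_eq]
  refine Quotient.sound (GradedSemisimpleAlgebra.isomorphic_of_basis (v q.out) (v q'.out)
    (d q.out) (hd _) ?_ fun s t k => ?_)
  · rw [show d q.out = d q'.out from congrArg Prod.fst hq]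
    exact hd _
  · exact congrArg Subtype.val (congrFun (congrFun (congrFun (congrArg Prod.snd hq) s) t) k)
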